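/- Let $0\le\omega<1$. For an incidence angle $\theta_0\in(-\pi/2,\pi/2)$ put $\mu_0=\cos\theta_0$, and write $\mu=\cos\theta$. Consider the half-space albedo problem with isotropic (azimuth-independent) scattering for the diffuse flux $\psi_d(\theta,\tau)$, $-\pi<\theta\le\pi$, $\tau\ge 0$: $$\mu\,\frac{\partial\psi_d}{\partial\tau}(\theta,\tau)+\psi_d(\theta,\tau)=\frac{\omega}{2\pi}\int_{-\pi}^{\pi}\psi_d(\theta',\tau)\,d\theta'+\frac{\omega}{2\pi}e^{-\tau/\mu_0}\qquad(\tau>0),$$ $$\psi_d(\theta,0)=0\quad\text{for } |\theta|\le\pi/2 .$$ In the two directions with $\mu=0$ the derivative term is absent. A solution is understood to be integrable in $\theta$ at each depth $\tau>0$, to be differentiable in $\tau>0$ and continuous at $\tau=0$ for each direction with $\mu\ne0$, and to be such that $e^{-s\tau}\psi_d$ is, for every $s>0$, absolutely integrable over $\tau>0$ for each $\theta$ and over $(\theta,\tau)$ jointly (i.e. $\psi_d$ has a Laplace transform in $\tau$ for $\operatorname{Re}s>0$). Then a solution exists for every $\theta_0\in(-\pi/2,\pi/2)$, and the emergent flux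 of the solutions is described by a single function $D$ of two cosines in $(0,1]$, defined by $$\psi_d(\theta,0)=-\mu^{-1}D(-\mu,\mu_0)\qquad(\pi/2<|\theta|\le\pi,\ |\theta_0|<\pi/2).$$ This function is symmetric under interchange of the incident and emergent directions: $$D(\mu_0,-\mu)=D(-\mu,\mu_0)\qquad\text{for all } \theta_0,\theta \text{ with } |\theta_0|<\pi/2<|\theta|\le\pi .$$ -/

import Mathlib

open MeasureTheory Set

/-- `IsDiffuseFlux ω θ₀ ψ`: the function `ψ θ τ` (azimuth `-π < θ ≤ π`, optical depth `τ ≥ 0`) is the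
diffuse photon flux in the half space `τ ≥ 0` with single-scattering albedo `ω`, isotropic scattering
and unit plane-wave irradiation at azimuth `θ₀`. Throughout `μ = cos θ` and `μ₀ = cos θ₀`. -/
structure IsDiffuseFlux (ω θ₀ : ℝ) (ψ : ℝ → ℝ → ℝ) : Prop where
  /-- At each depth the angular aggregate `∫ ψ(θ', τ) dθ'` is meaningful. -/
  integrable_angle : ∀ τ : ℝ, 0 < τ →
    IntervalIntegrable (fun θ' => ψ θ' τ) volume (-Real.pi) Real.pi
  /-- The `τ`-derivative exists inside the medium. In the two grazing directions `μ = 0` the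
  derivative is absent from the transport equation and is not asked for. -/
  differentiable : ∀ θ ∈ Ioc (-Real.pi) Real.pi, Real.cos θ ≠ 0 →
    ∀ τ : ℝ, 0 < τ → DifferentiableAt ℝ (ψ θ) τ
  /-- The boundary values at `τ = 0` are attained, again off the grazing directions. -/
  continuous_zero : ∀ θ ∈ Ioc (-Real.pi) Real.pi, Real.cos θ ≠ 0 →
    ContinuousWithinAt (ψ θ) (Ici 0) 0
  /-- The transport (Boltzmann) equation for the diffuse flux,
  `μ ∂ψ/∂τ + ψ = (ω/2π) ∫ ψ(θ', τ) dθ' + (ω/2π) exp (-τ/μ₀)`. -/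
  transport : ∀ θ ∈ Ioc (-Real.pi) Real.pi, ∀ τ : ℝ, 0 < τ →
    Real.cos θ * deriv (ψ θ) τ + ψ θ τ =
      ω / (2 * Real.pi) * (∫ θ' in (-Real.pi)..Real.pi, ψ θ' τ)
        + ω / (2 * Real.pi) * Real.exp (-τ / Real.cos θ₀)
  /-- No reentrant diffuse flux at the boundary of the half space. -/
  no_reentrant : ∀ θ : ℝ, |θ| ≤ Real.pi / 2 → ψ θ 0 = 0
  /-- The flux in each direction has a Laplace transform in `τ` on `Re s > 0`. -/
  laplace : ∀ θ ∈ Ioc (-Real.pi) Real.pi, ∀ s : ℝ, 0 < s →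
    IntegrableOn (fun τ => Real.exp (-s * τ) * ψ θ τ) (Ioi 0)
  /-- The same jointly in angle and depth, so that the density `∫ ψ(θ', τ) dθ'` has one too. -/
  laplace_joint : ∀ s : ℝ, 0 < s →
    IntegrableOn (fun p : ℝ × ℝ => Real.exp (-s * p.2) * ψ p.1 p.2)
      (Ioc (-Real.pi) Real.pi ×ˢ Ioi 0)

/-- `IsDiffuseReflection ω D`: the function `D` is defined, on pairs (emergent cosine, incident
cosine), by `ψ(θ, 0) = -μ⁻¹ D(-μ, μ₀)` for all incident azimuths `θ₀`, all emergent azimuths `θ`,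
and `ψ` the diffuse flux under irradiation at `θ₀`. -/
def IsDiffuseReflection (ω : ℝ) (D : ℝ → ℝ → ℝ) : Prop :=
  ∀ θ₀ ∈ Ioo (-(Real.pi / 2)) (Real.pi / 2), ∀ ψ : ℝ → ℝ → ℝ, IsDiffuseFlux ω θ₀ ψ →
    ∀ θ ∈ Ioc (-Real.pi) Real.pi, Real.pi / 2 < |θ| →
      ψ θ 0 = -(Real.cos θ)⁻¹ * D (-Real.cos θ) (Real.cos θ₀)

/-!
A contraction in an exponentially weighted sup norm yields, for every incidence, a solution that
decays exponentially and depends on the direction through its cosine only. If `ψ` and `φ` solve the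
transport equation in opposite directions, with sources `S` and `R`, then `μ (ψ φ)' = S φ - ψ R`.
One of two opposite directions enters the half space, so the boundary term vanishes, and integration
over depth and angle gives `∫ S (∫ φ dθ) dτ = ∫ (∫ ψ dθ) R dτ`. Inserting the definition of the
sources turns this into a reciprocity between their Laplace transforms at the two cosines, which are
the emergent fluxes. Here only `φ` has to be the decaying solution: letting `ψ` be any solution at a
given incidence shows that `D` is well defined, and a decaying `ψ` gives its symmetry.
-/

open Real Filter Topology

section WeightedIntegrability

lemma aestronglyMeasurable_of_mul_left {α : Type*} [MeasurableSpace α] {ν : Measure α}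
    {w g : α → ℝ} (hw : AEStronglyMeasurable w ν) (hw0 : ∀ x, w x ≠ 0)
    (hg : AEStronglyMeasurable (fun x => w x * g x) ν) : AEStronglyMeasurable g ν :=
  (hw.inv₀.mul hg).congr <| ae_of_all _ fun x => inv_mul_cancel_left₀ (hw0 x) (g x)

lemma integrable_mul_of_abs_le_mul {α : Type*} [MeasurableSpace α] {ν : Measure α}
    {w g k : α → ℝ} {M : ℝ} (hw : AEStronglyMeasurable w ν) (hw0 : ∀ x, 0 < w x)
    (hg : Integrable (fun x => w x * g x) ν) (hk : AEStronglyMeasurable k ν)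
    (hM : ∀ᵐ x ∂ν, |k x| ≤ M * w x) : Integrable (fun x => g x * k x) ν := by
  have hbound : ∀ᵐ x ∂ν, ‖(w x)⁻¹ * k x‖ ≤ M := by
    filter_upwards [hM] with x hx
    rw [inv_mul_eq_div, norm_div, Real.norm_eq_abs, Real.norm_of_nonneg (hw0 x).le]
    exact (div_le_iff₀ (hw0 x)).2 hx
  refine (hg.mul_bdd (hw.inv₀.mul hk) hbound).congr <| ae_of_all _ fun x => ?_
  have := (hw0 x).ne'
  simp only [Pi.mul_apply, Pi.inv_apply]
  field_simp

lemma integrableOn_mul_of_abs_le_exp {s M : ℝ} {g k : ℝ → ℝ}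
    (hg : IntegrableOn (fun τ => exp (-s * τ) * g τ) (Ioi 0))
    (hk : AEStronglyMeasurable k (volume.restrict (Ioi 0)))
    (hM : ∀ τ, 0 < τ → |k τ| ≤ M * exp (-s * τ)) :
    IntegrableOn (fun τ => g τ * k τ) (Ioi 0) :=
  integrable_mul_of_abs_le_mul (w := fun τ => exp (-s * τ)) (by fun_prop) (fun _ => exp_pos _) hg
    hk ((ae_restrict_iff' measurableSet_Ioi).2 (ae_of_all _ hM))

lemma volume_restrict_prod (A B : Set ℝ) :
    (volume : Measure (ℝ × ℝ)).restrict (A ×ˢ B) =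
      (volume.restrict A).prod (volume.restrict B) := by
  rw [Measure.volume_eq_prod, Measure.prod_restrict]

lemma integrableOn_comp_snd {a b : ℝ} {B : Set ℝ} {g : ℝ → ℝ} (hg : IntegrableOn g B) :
    IntegrableOn (fun p : ℝ × ℝ => g p.2) (Ioc a b ×ˢ B) := by
  rw [IntegrableOn, volume_restrict_prod]
  exact hg.integrable.comp_snd _

lemma intervalIntegral_setIntegral_swap {F : ℝ → ℝ → ℝ} {a b : ℝ} {B : Set ℝ} (hab : a ≤ b)
    (hF : IntegrableOn (fun p : ℝ × ℝ => F p.1 p.2) (Ioc a b ×ˢ B)) :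
    ∫ x in a..b, ∫ y in B, F x y = ∫ y in B, ∫ x in a..b, F x y := by
  rw [IntegrableOn, volume_restrict_prod] at hF
  simp only [intervalIntegral.integral_of_le hab]
  exact integral_integral_swap hF

end WeightedIntegrability

section Transport

variable {μ : ℝ} {S R ψ φ : ℝ → ℝ}

/-- `φ` solves the transport equation `μ φ' + φ = S` at positive depths along a fixed direction of
cosine `μ`, with attained boundary value at depth `0`. -/
structure SolvesTransport (μ : ℝ) (S φ : ℝ → ℝ) : Prop where
  continuous_zero : ContinuousWithinAt φ (Ici 0) 0
  differentiable : ∀ τ, 0 < τ → DifferentiableAt ℝ φ τ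
  transport : ∀ τ, 0 < τ → μ * deriv φ τ + φ τ = S τ

lemma solvesTransport_exp (hμ : μ ≠ 0) : SolvesTransport μ 0 fun τ => exp (-τ / μ) where
  continuous_zero := by fun_prop
  differentiable τ _ := by fun_prop
  transport τ _ := by
    have hderiv : HasDerivAt (fun τ => exp (-τ / μ)) (exp (-τ / μ) * (-1 / μ)) τ :=
      ((hasDerivAt_id τ).neg.div_const μ).exp
    rw [hderiv.deriv, Pi.zero_apply]
    field_simp
    ring

/-- Green's identity: `μ (ψ φ)' = S φ - ψ R` for solutions `ψ` and `φ` in opposite directions. -/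
lemma SolvesTransport.integral_mul_sub_integral_mul (hψ : SolvesTransport μ S ψ)
    (hφ : SolvesTransport (-μ) R φ) (hψφ : IntegrableOn (fun τ => ψ τ * φ τ) (Ioi 0))
    (hSφ : IntegrableOn (fun τ => S τ * φ τ) (Ioi 0))
    (hψR : IntegrableOn (fun τ => ψ τ * R τ) (Ioi 0)) :
    (∫ τ in Ioi 0, S τ * φ τ) - ∫ τ in Ioi 0, ψ τ * R τ = -(μ * (ψ 0 * φ 0)) := by
  have hderiv : ∀ τ ∈ Ioi (0 : ℝ),
      HasDerivAt (fun τ => μ * (ψ τ * φ τ)) (S τ * φ τ - ψ τ * R τ) τ := fun τ hτ => by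
    refine (((hψ.differentiable τ hτ).hasDerivAt.mul
      (hφ.differentiable τ hτ).hasDerivAt).const_mul μ).congr_deriv ?_
    linear_combination φ τ * hψ.transport τ hτ - ψ τ * hφ.transport τ hτ
  have hlim : Tendsto (fun τ => μ * (ψ τ * φ τ)) atTop (𝓝 0) :=
    tendsto_zero_of_hasDerivAt_of_integrableOn_Ioi hderiv (hSφ.sub hψR) (hψφ.const_mul μ)
  rw [← integral_sub hSφ hψR, ← zero_sub]
  exact integral_Ioi_of_hasDerivAt_of_tendsto
    ((hψ.continuous_zero.mul hφ.continuous_zero).const_mul μ) hderiv (hSφ.sub hψR) hlim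

end Transport

section Streamed

variable {h : ℝ → ℝ} {M ε μ τ : ℝ}

/-- The flux at depth `τ` in a direction of cosine `μ` that the source density `h` produces, with
`u` the optical path back to the point of emission. -/
noncomputable def streamed (μ : ℝ) (h : ℝ → ℝ) (τ : ℝ) : ℝ :=
  ∫ u in Ioi 0, exp (-u) * h (τ - μ * u)

lemma streamed_zero_cos (h : ℝ → ℝ) (τ : ℝ) : streamed 0 h τ = h τ := by
  simp only [streamed, zero_mul, sub_zero, integral_mul_const, integral_exp_neg_Ioi_zero, one_mul]

lemma streamed_zero_depth (h0 : ∀ t ≤ 0, h t = 0) (hμ : 0 ≤ μ) : streamed μ h 0 = 0 := by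
  refine setIntegral_eq_zero_of_forall_eq_zero fun u (hu : 0 < u) => ?_
  rw [h0 _ (by linarith [mul_nonneg hμ hu.le]), mul_zero]

lemma measurable_streamed (hm : Measurable h) : Measurable fun p : ℝ × ℝ => streamed p.1 h p.2 := by
  have hint : Measurable fun p : (ℝ × ℝ) × ℝ => exp (-p.2) * h (p.1.2 - p.1.1 * p.2) := by
    fun_prop
  exact hint.stronglyMeasurable.integral_prod_right.measurable

lemma measurable_streamed_cos (hm : Measurable h) :
    Measurable fun p : ℝ × ℝ => streamed (cos p.1) h p.2 :=
  (measurable_streamed hm).comp (by fun_prop : Measurable fun p : ℝ × ℝ => (cos p.1, p.2))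

lemma integrableOn_exp_neg_mul (hm : Measurable h) (hM : ∀ t, |h t| ≤ M) (c : ℝ) :
    IntegrableOn (fun u => exp (-u) * h u) (Ioi c) :=
  (integrableOn_exp_neg_Ioi c).mul_bdd hm.aestronglyMeasurable (ae_of_all _ hM)

lemma streamed_sub {k : ℝ → ℝ} {N : ℝ} (hm : Measurable h) (hM : ∀ t, |h t| ≤ M)
    (km : Measurable k) (kN : ∀ t, |k t| ≤ N) :
    streamed μ (h - k) τ = streamed μ h τ - streamed μ k τ := by
  simp only [streamed, Pi.sub_apply, mul_sub]
  exact integral_sub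
    (integrableOn_exp_neg_mul (h := fun u => h (τ - μ * u)) (by fun_prop) (fun _ => hM _) 0)
    (integrableOn_exp_neg_mul (h := fun u => k (τ - μ * u)) (by fun_prop) (fun _ => kN _) 0)

lemma abs_streamed_le_exp (hε0 : 0 ≤ ε) (hε1 : ε < 1) (hM : ∀ t, |h t| ≤ M * exp (-ε * |t|))
    (hμ : |μ| ≤ 1) : |streamed μ h τ| ≤ M / (1 - ε) * exp (-ε * |τ|) := by
  have hM0 : 0 ≤ M := by simpa using (abs_nonneg _).trans (hM 0)
  have hε : -(1 - ε) < 0 := by linarith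
  have hpath : ∀ u, 0 < u → |τ| - u ≤ |τ - μ * u| := fun u hu => by
    have : |μ * u| ≤ u := by
      rw [abs_mul, abs_of_pos hu]
      exact mul_le_of_le_one_left hu.le hμ
    linarith [abs_sub_abs_le_abs_sub τ (μ * u)]
  have hbound : ∀ᵐ u ∂volume.restrict (Ioi 0),
      ‖exp (-u) * h (τ - μ * u)‖ ≤ M * exp (-ε * |τ|) * exp (-(1 - ε) * u) := by
    filter_upwards [ae_restrict_mem measurableSet_Ioi] with u hu
    calc ‖exp (-u) * h (τ - μ * u)‖ = exp (-u) * |h (τ - μ * u)| := by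
          rw [norm_mul, Real.norm_eq_abs, Real.norm_eq_abs, abs_exp]
      _ ≤ exp (-u) * (M * exp (-ε * (|τ| - u))) := by
          gcongr
          refine (hM _).trans ?_
          gcongr M * exp ?_
          simpa only [neg_mul, neg_le_neg_iff] using mul_le_mul_of_nonneg_left (hpath u hu) hε0
      _ = M * exp (-ε * |τ|) * exp (-(1 - ε) * u) := by
          rw [mul_left_comm, mul_assoc, ← exp_add, ← exp_add]
          ring_nf
  have hle := norm_integral_le_of_norm_le ((integrableOn_exp_mul_Ioi hε 0).const_mul _) hbound
  rwa [integral_const_mul, integral_exp_mul_Ioi hε, mul_zero, exp_zero, neg_div_neg_eq,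
    mul_one_div, mul_div_right_comm, Real.norm_eq_abs] at hle

lemma abs_le_of_abs_le_exp (hε0 : 0 ≤ ε) (hM : ∀ t, |h t| ≤ M * exp (-ε * |t|)) (t : ℝ) :
    |h t| ≤ M := by
  have hM0 : 0 ≤ M := by simpa using (abs_nonneg _).trans (hM 0)
  refine (hM t).trans (mul_le_of_le_one_right hM0 (exp_le_one_iff.2 ?_))
  simpa using mul_nonneg hε0 (abs_nonneg t)

lemma abs_streamed_le (hM : ∀ t, |h t| ≤ M) (hμ : |μ| ≤ 1) : |streamed μ h τ| ≤ M := by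
  simpa using abs_streamed_le_exp (τ := τ) le_rfl one_pos (by simpa using hM) hμ

/-- Variation of constants for `μ φ' + φ = h`. -/
lemma streamed_eq_primitive (hm : Measurable h) (hM : ∀ t, |h t| ≤ M) (hμ : μ ≠ 0) (τ : ℝ) :
    streamed μ h τ =
      exp (-τ / μ) * (streamed μ h 0 + μ⁻¹ * ∫ t in (0 : ℝ)..τ, exp (t / μ) * h t) := by
  set F : ℝ → ℝ := fun w => exp (-w) * h (0 - μ * w) with hF
  have hFint : ∀ c, IntegrableOn F (Ioi c) :=
    integrableOn_exp_neg_mul (by fun_prop) fun _ => hM _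
  have hshift : streamed μ h τ = exp (-τ / μ) * ∫ w in Ioi (-τ / μ), F w := by
    have htranslate := (measurePreserving_sub_right volume (τ / μ)).setIntegral_preimage_emb
      (measurableEmbedding_subRight _) F (Ioi (-τ / μ))
    rw [preimage_sub_const_Ioi, neg_div, neg_add_cancel] at htranslate
    rw [neg_div, ← htranslate, ← integral_const_mul, streamed]
    congr! 2
    rw [hF, ← mul_assoc, ← exp_add]
    congr 2
    · ring
    · field_simp
      ring
  have hsplit : ∫ w in Ioi (-τ / μ), F w = (∫ w in (-τ / μ)..0, F w) + streamed μ h 0 :=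
    (intervalIntegral.integral_interval_add_Ioi (hFint _) (hFint 0)).symm
  have hsubst : ∫ w in (-τ / μ)..0, F w = μ⁻¹ * ∫ t in (0 : ℝ)..τ, exp (t / μ) * h t := by
    have := intervalIntegral.integral_comp_sub_mul (a := -τ / μ) (b := 0)
      (fun t => exp (t / μ) * h t) hμ 0
    rw [mul_zero, sub_zero, mul_div_cancel₀ _ hμ, zero_sub, neg_neg, smul_eq_mul] at this
    rw [← this]
    refine intervalIntegral.integral_congr fun w _ => ?_
    have hw : (0 - μ * w) / μ = -w := by field_simp; ring
    simp only [hF, hw]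
  rw [hshift, hsplit, hsubst, add_comm]

lemma intervalIntegrable_exp_div_mul (hm : Measurable h) (hM : ∀ t, |h t| ≤ M) (μ a b : ℝ) :
    IntervalIntegrable (fun t => exp (t / μ) * h t) volume a b := by
  have hexp : IntervalIntegrable (fun t => exp (t / μ)) volume a b :=
    Continuous.intervalIntegrable (by fun_prop) a b
  exact intervalIntegrable_iff.2 <| (intervalIntegrable_iff.1 hexp).mul_bdd
    hm.aestronglyMeasurable (ae_of_all _ hM)

lemma continuous_streamed (hm : Measurable h) (hM : ∀ t, |h t| ≤ M) (hμ : μ ≠ 0) :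
    Continuous (streamed μ h) := by
  rw [funext (streamed_eq_primitive hm hM hμ)]
  have := intervalIntegral.continuous_primitive (intervalIntegrable_exp_div_mul hm hM μ) 0
  fun_prop

lemma hasDerivAt_streamed (hm : Measurable h) (hM : ∀ t, |h t| ≤ M) (hμ : μ ≠ 0)
    (hc : ContinuousAt h τ) : HasDerivAt (streamed μ h) ((h τ - streamed μ h τ) / μ) τ := by
  have hmeas : Measurable fun t => exp (t / μ) * h t := by fun_prop
  have hprim : HasDerivAt (fun τ => ∫ t in (0 : ℝ)..τ, exp (t / μ) * h t) (exp (τ / μ) * h τ) τ :=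
    intervalIntegral.integral_hasDerivAt_right (intervalIntegrable_exp_div_mul hm hM μ 0 τ)
      hmeas.stronglyMeasurable.stronglyMeasurableAtFilter (by fun_prop)
  have hexp : HasDerivAt (fun τ => exp (-τ / μ)) (exp (-τ / μ) * (-1 / μ)) τ :=
    ((hasDerivAt_id τ).neg.div_const μ).exp
  have hcancel : exp (-τ / μ) * exp (τ / μ) = 1 := by rw [← exp_add, neg_div]; simp
  have hprod := hexp.mul ((hprim.const_mul μ⁻¹).const_add (streamed μ h 0))
  refine (hprod.congr_of_eventuallyEq <| Eventually.of_forall <|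
    streamed_eq_primitive hm hM hμ).congr_deriv ?_
  rw [streamed_eq_primitive hm hM hμ τ]
  linear_combination (h τ / μ) * hcancel

lemma solvesTransport_streamed (hm : Measurable h) (hM : ∀ t, |h t| ≤ M)
    (hc : ∀ τ, 0 < τ → ContinuousAt h τ) (hμ : μ ≠ 0) :
    SolvesTransport μ h (streamed μ h) where
  continuous_zero := (continuous_streamed hm hM hμ).continuousWithinAt
  differentiable τ hτ := (hasDerivAt_streamed hm hM hμ (hc τ hτ)).differentiableAt
  transport τ hτ := by
    rw [(hasDerivAt_streamed hm hM hμ (hc τ hτ)).deriv]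
    field_simp
    ring

end Streamed

section AngularFlux

variable {h k : ℝ → ℝ} {M N ε τ : ℝ}

/-- The flux at depth `τ`, aggregated over all directions, that the source density `h` produces. -/
noncomputable def angularFlux (h : ℝ → ℝ) (τ : ℝ) : ℝ :=
  ∫ θ in (-π)..π, streamed (cos θ) h τ

lemma ae_cos_ne_zero : ∀ᵐ θ : ℝ, cos θ ≠ 0 := by
  have hzeros : {θ : ℝ | cos θ = 0} ⊆ range fun n : ℤ => (2 * n + 1) * π / 2 := fun θ hθ => by
    obtain ⟨n, hn⟩ := cos_eq_zero_iff.1 hθ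
    exact ⟨n, hn.symm⟩
  exact ((countable_range _).mono hzeros).ae_notMem volume

lemma intervalIntegrable_streamed_cos (hm : Measurable h) (hM : ∀ t, |h t| ≤ M) (τ a b : ℝ) :
    IntervalIntegrable (fun θ => streamed (cos θ) h τ) volume a b := by
  have hmeas : Measurable fun θ => streamed (cos θ) h τ :=
    (measurable_streamed_cos hm).comp measurable_prodMk_right
  exact (intervalIntegrable_const (c := M)).mono_fun' hmeas.aestronglyMeasurable <|
    ae_of_all _ fun θ => abs_streamed_le hM (abs_cos_le_one θ)

lemma continuous_angularFlux (hm : Measurable h) (hM : ∀ t, |h t| ≤ M) :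
    Continuous (angularFlux h) := by
  refine intervalIntegral.continuous_of_dominated_interval (bound := fun _ => M)
    (fun τ => ?_) (fun τ => ae_of_all _ fun θ _ => abs_streamed_le hM (abs_cos_le_one θ))
    intervalIntegrable_const ?_
  · exact ((measurable_streamed_cos hm).comp measurable_prodMk_right).aestronglyMeasurable
  · filter_upwards [ae_cos_ne_zero] with θ hθ _ using continuous_streamed hm hM hθ

lemma angularFlux_sub (hm : Measurable h) (hM : ∀ t, |h t| ≤ M) (km : Measurable k)
    (kN : ∀ t, |k t| ≤ N) : angularFlux (h - k) τ = angularFlux h τ - angularFlux k τ := by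
  simp only [angularFlux, streamed_sub hm hM km kN]
  exact intervalIntegral.integral_sub (intervalIntegrable_streamed_cos hm hM τ _ _)
    (intervalIntegrable_streamed_cos km kN τ _ _)

lemma abs_angularFlux_le_exp (hε0 : 0 ≤ ε) (hε1 : ε < 1)
    (hM : ∀ t, |h t| ≤ M * exp (-ε * |t|)) :
    |angularFlux h τ| ≤ 2 * π * (M / (1 - ε)) * exp (-ε * |τ|) := by
  have hle := intervalIntegral.norm_integral_le_of_norm_le_const (a := -π) (b := π)
    (f := fun θ => streamed (cos θ) h τ)
    (fun θ _ => abs_streamed_le_exp (τ := τ) hε0 hε1 hM (abs_cos_le_one θ))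
  rw [sub_neg_eq_add, abs_of_pos (by positivity : 0 < π + π)] at hle
  exact hle.trans_eq (by ring)

end AngularFlux

section FixedPoint

open scoped BoundedContinuousFunction

lemma exists_eq_smul_add_of_norm_le {E : Type*} [NormedAddCommGroup E] [NormedSpace ℝ E]
    [CompleteSpace E] {K : E → E} {a C : ℝ} (hsub : ∀ g k, K (g - k) = K g - K k) (hC : 0 ≤ C)
    (hK : ∀ g, ‖K g‖ ≤ C * ‖g‖) (ha : |a| * C < 1) (b : E) : ∃ g, g = a • K g + b := by
  have hcontr : ContractingWith (|a| * C).toNNReal fun g => a • K g + b := by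
    refine ⟨Real.toNNReal_lt_one.2 ha, LipschitzWith.of_dist_le_mul fun g k => ?_⟩
    rw [Real.coe_toNNReal _ (by positivity), dist_add_right, dist_smul₀, dist_eq_norm,
      dist_eq_norm, ← hsub, Real.norm_eq_abs, mul_assoc]
    gcongr
    exact hK _
  exact ⟨_, hcontr.fixedPoint_isFixedPt.symm⟩

variable {ε : ℝ}

/-- The source density `h`, supported in `τ > 0`, whose weighted density `exp (ε τ) h τ` is `g`. -/
noncomputable def damped (ε : ℝ) (g : ℝ → ℝ) : ℝ → ℝ :=
  indicator (Ioi 0) fun t => exp (-ε * |t|) * g t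

lemma measurable_damped {g : ℝ → ℝ} (hg : Measurable g) : Measurable (damped ε g) :=
  Measurable.indicator (by fun_prop) measurableSet_Ioi

lemma damped_sub (ε : ℝ) (g k : ℝ → ℝ) : damped ε (g - k) = damped ε g - damped ε k := by
  simp only [damped, ← indicator_sub, Pi.sub_def, mul_sub]

lemma abs_damped_le_exp (g : ℝ →ᵇ ℝ) (t : ℝ) : |damped ε g t| ≤ ‖g‖ * exp (-ε * |t|) := by
  refine (norm_indicator_le_norm_self (fun t => exp (-ε * |t|) * g t) t).trans ?_
  rw [norm_mul, Real.norm_of_nonneg (exp_pos _).le, mul_comm]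
  gcongr
  exact g.norm_coe_le_norm t

lemma abs_damped_le (hε0 : 0 ≤ ε) (g : ℝ →ᵇ ℝ) (t : ℝ) : |damped ε g t| ≤ ‖g‖ :=
  abs_le_of_abs_le_exp hε0 (abs_damped_le_exp g) t

lemma abs_exp_mul_angularFlux_le (hε0 : 0 ≤ ε) (hε1 : ε < 1) (g : ℝ →ᵇ ℝ) (τ : ℝ) :
    |exp (ε * |τ|) * angularFlux (damped ε g) τ| ≤ 2 * π / (1 - ε) * ‖g‖ := by
  rw [abs_mul, abs_exp]
  calc exp (ε * |τ|) * |angularFlux (damped ε g) τ|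
      ≤ exp (ε * |τ|) * (2 * π * (‖g‖ / (1 - ε)) * exp (-ε * |τ|)) := by
        gcongr
        exact abs_angularFlux_le_exp hε0 hε1 (abs_damped_le_exp g)
    _ = 2 * π / (1 - ε) * ‖g‖ * (exp (ε * |τ|) * exp (-ε * |τ|)) := by ring
    _ = 2 * π / (1 - ε) * ‖g‖ := by rw [← exp_add, neg_mul, add_neg_cancel, exp_zero, mul_one]

/-- The operator `h ↦ angularFlux h`, conjugated by the weight `exp (ε τ)` so as to act on bounded
functions: its fixed points are source densities that decay like `exp (-ε τ)`. -/
noncomputable def weightedFlux (hε0 : 0 ≤ ε) (hε1 : ε < 1) (g : ℝ →ᵇ ℝ) : ℝ →ᵇ ℝ :=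
  .ofNormedAddCommGroup (fun τ => exp (ε * |τ|) * angularFlux (damped ε g) τ)
    ((by fun_prop : Continuous fun τ => exp (ε * |τ|)).mul <|
      continuous_angularFlux (measurable_damped g.continuous.measurable) (abs_damped_le hε0 g))
    (2 * π / (1 - ε) * ‖g‖) (abs_exp_mul_angularFlux_le hε0 hε1 g)

lemma weightedFlux_sub (hε0 : 0 ≤ ε) (hε1 : ε < 1) (g k : ℝ →ᵇ ℝ) :
    weightedFlux hε0 hε1 (g - k) = weightedFlux hε0 hε1 g - weightedFlux hε0 hε1 k := by
  ext τ
  have hlinear := angularFlux_sub (τ := τ) (measurable_damped g.continuous.measurable)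
    (abs_damped_le hε0 g) (measurable_damped k.continuous.measurable) (abs_damped_le hε0 k)
  rw [← damped_sub, ← BoundedContinuousFunction.coe_sub] at hlinear
  simp only [weightedFlux, BoundedContinuousFunction.coe_ofNormedAddCommGroup,
    BoundedContinuousFunction.coe_sub, Pi.sub_apply, ← mul_sub, ← hlinear]

lemma norm_weightedFlux_le (hε0 : 0 ≤ ε) (hε1 : ε < 1) (g : ℝ →ᵇ ℝ) :
    ‖weightedFlux hε0 hε1 g‖ ≤ 2 * π / (1 - ε) * ‖g‖ := by
  refine BoundedContinuousFunction.norm_ofNormedAddCommGroup_le _ ?_ _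
  have := sub_pos.2 hε1
  positivity

lemma exists_decaying_source {ω μ₀ : ℝ} (hε0 : 0 ≤ ε) (hωε : ε + |ω| < 1) (hμ₀ : 0 < μ₀)
    (hμ₁ : μ₀ ≤ 1) :
    ∃ (h : ℝ → ℝ) (M : ℝ), Measurable h ∧ (∀ t ≤ 0, h t = 0) ∧
      (∀ t, |h t| ≤ M * exp (-ε * |t|)) ∧ ∀ τ, 0 < τ →
        h τ = ω / (2 * π) * angularFlux h τ + ω / (2 * π) * exp (-τ / μ₀) := by
  have hε1 : ε < 1 := by linarith [abs_nonneg ω]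
  have hrate : ∀ τ : ℝ, ε * |τ| ≤ |τ| / μ₀ := fun τ =>
    (mul_le_of_le_one_left (abs_nonneg τ) hε1.le).trans (le_div_self (abs_nonneg τ) hμ₀ hμ₁)
  let b : ℝ →ᵇ ℝ := .ofNormedAddCommGroup
    (fun τ => ω / (2 * π) * exp (ε * |τ| - |τ| / μ₀)) (by fun_prop) |ω / (2 * π)| fun τ => by
      rw [Real.norm_eq_abs, abs_mul, abs_exp]
      exact mul_le_of_le_one_right (abs_nonneg _) (exp_le_one_iff.2 (sub_nonpos.2 (hrate τ)))
  have hcontr : |ω / (2 * π)| * (2 * π / (1 - ε)) < 1 := by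
    rw [abs_div, abs_of_pos two_pi_pos, div_mul_div_cancel₀ two_pi_pos.ne',
      div_lt_one (by linarith)]
    linarith
  obtain ⟨g, hg⟩ := exists_eq_smul_add_of_norm_le (weightedFlux_sub hε0 hε1)
    (div_nonneg two_pi_pos.le (sub_nonneg.2 hε1.le)) (norm_weightedFlux_le hε0 hε1) hcontr b
  refine ⟨damped ε g, ‖g‖, measurable_damped g.continuous.measurable,
    fun t ht => indicator_of_notMem (notMem_Ioi.2 ht) _, abs_damped_le_exp g, fun τ hτ => ?_⟩
  have hfix : g τ = ω / (2 * π) * (exp (ε * |τ|) * angularFlux (damped ε g) τ) +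
      ω / (2 * π) * exp (ε * |τ| - |τ| / μ₀) := DFunLike.congr_fun hg τ
  have hcancel : exp (-ε * |τ|) * exp (ε * |τ|) = 1 := by
    rw [← exp_add, neg_mul, neg_add_cancel, exp_zero]
  have hbeam : exp (ε * |τ| - |τ| / μ₀) = exp (ε * |τ|) * exp (-τ / μ₀) := by
    rw [← exp_add, abs_of_pos hτ, neg_div, sub_eq_add_neg]
  calc damped ε g τ = exp (-ε * |τ|) * g τ := indicator_of_mem (mem_Ioi.2 hτ) _
    _ = _ := by
      rw [hfix, hbeam]
      linear_combination (ω / (2 * π) * (angularFlux (damped ε g) τ + exp (-τ / μ₀))) * hcancel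

end FixedPoint

section DecayingFlux

variable {ω θ₀ M : ℝ} {h : ℝ → ℝ}

lemma isDiffuseFlux_streamed (hm : Measurable h) (h0 : ∀ t ≤ 0, h t = 0) (hM : ∀ t, |h t| ≤ M)
    (hsource : ∀ τ, 0 < τ →
      h τ = ω / (2 * π) * angularFlux h τ + ω / (2 * π) * exp (-τ / cos θ₀)) :
    IsDiffuseFlux ω θ₀ fun θ => streamed (cos θ) h := by
  have hcontinuous : Continuous fun τ =>
      ω / (2 * π) * angularFlux h τ + ω / (2 * π) * exp (-τ / cos θ₀) := by
    have := continuous_angularFlux hm hM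
    fun_prop
  have hc : ∀ τ, 0 < τ → ContinuousAt h τ := fun τ hτ =>
    hcontinuous.continuousAt.congr <| by
      filter_upwards [Ioi_mem_nhds hτ] with t ht using (hsource t ht).symm
  have hsolves {θ : ℝ} (hθ : cos θ ≠ 0) : SolvesTransport (cos θ) h (streamed (cos θ) h) :=
    solvesTransport_streamed hm hM hc hθ
  exact {
    integrable_angle := fun τ _ => intervalIntegrable_streamed_cos hm hM τ _ _
    differentiable := fun θ _ hθ => (hsolves hθ).differentiable
    continuous_zero := fun θ _ hθ => (hsolves hθ).continuous_zero
    transport := fun θ _ τ hτ => by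
      refine Eq.trans ?_ (hsource τ hτ)
      by_cases hθ : cos θ = 0
      · rw [hθ, zero_mul, zero_add, streamed_zero_cos]
      · exact (hsolves hθ).transport τ hτ
    no_reentrant := fun θ hθ => streamed_zero_depth h0 (cos_nonneg_of_mem_Icc (abs_le.1 hθ))
    laplace := fun θ _ s hs => (integrableOn_exp_mul_Ioi (neg_neg_of_pos hs) 0).mul_bdd
      ((measurable_streamed_cos hm).comp measurable_prodMk_left).aestronglyMeasurable
      (ae_of_all _ fun τ => abs_streamed_le hM (abs_cos_le_one θ))
    laplace_joint := fun s hs => (integrableOn_comp_snd <|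
        integrableOn_exp_mul_Ioi (neg_neg_of_pos hs) 0).mul_bdd
      (measurable_streamed_cos hm).aestronglyMeasurable
      (ae_of_all _ fun p => abs_streamed_le hM (abs_cos_le_one p.1)) }

/-- A diffuse flux that depends on the direction through its cosine only (`Φ μ τ`, rather than
`ψ θ τ`) and decays exponentially with depth, uniformly in the direction. -/
structure IsDecayingFlux (ω θ₀ : ℝ) (Φ : ℝ → ℝ → ℝ) : Prop where
  isDiffuseFlux : IsDiffuseFlux ω θ₀ fun θ => Φ (cos θ)
  decay : ∃ ε ∈ Ioo (0 : ℝ) 1, ∃ M, ∀ θ τ, 0 < τ → |Φ (cos θ) τ| ≤ M * exp (-ε * τ)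

lemma exists_isDecayingFlux (hω : |ω| < 1) (hθ₀ : 0 < cos θ₀) : ∃ Φ, IsDecayingFlux ω θ₀ Φ := by
  obtain ⟨ε, hε0, hεω⟩ : ∃ ε, 0 < ε ∧ ε < 1 - |ω| := exists_between (sub_pos.2 hω)
  have hε1 : ε < 1 := by linarith [abs_nonneg ω]
  obtain ⟨h, M, hm, h0, hM, hsource⟩ :=
    exists_decaying_source hε0.le (by linarith : ε + |ω| < 1) hθ₀ (cos_le_one θ₀)
  refine ⟨fun μ => streamed μ h,
    isDiffuseFlux_streamed hm h0 (abs_le_of_abs_le_exp hε0.le hM) hsource,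
    ε, ⟨hε0, hε1⟩, M / (1 - ε), fun θ τ hτ => ?_⟩
  simpa only [abs_of_pos hτ] using
    abs_streamed_le_exp (τ := τ) hε0.le hε1 hM (abs_cos_le_one θ)

end DecayingFlux

section Source

variable {ω θ₀ θ s : ℝ} {ψ : ℝ → ℝ → ℝ}

/-- The source density of the flux `ψ`, that is the right-hand side of its transport equation. -/
noncomputable def source (ω θ₀ : ℝ) (ψ : ℝ → ℝ → ℝ) (τ : ℝ) : ℝ :=
  ω / (2 * π) * (∫ θ in (-π)..π, ψ θ τ) + ω / (2 * π) * exp (-τ / cos θ₀)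

/-- The Laplace transform of the source density in terms of the cosine `m`, with dual variable
`1 / m`. At `m = cos θ₁` it determines the flux emerging in the direction opposite to `θ₁`. -/
noncomputable def sourceLaplace (ω θ₀ : ℝ) (ψ : ℝ → ℝ → ℝ) (m : ℝ) : ℝ :=
  ∫ τ in Ioi 0, source ω θ₀ ψ τ * exp (-τ / m)

lemma integrableOn_mul_exp_neg_div {g : ℝ → ℝ} {m : ℝ} (hm : 0 < m)
    (hg : ∀ s, 0 < s → IntegrableOn (fun τ => exp (-s * τ) * g τ) (Ioi 0)) :
    IntegrableOn (fun τ => g τ * exp (-τ / m)) (Ioi 0) := by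
  refine (hg m⁻¹ (inv_pos.2 hm)).congr <| ae_of_all _ fun τ => ?_
  simp only [mul_comm (g τ), div_eq_mul_inv, neg_mul, mul_comm m⁻¹]

lemma IsDiffuseFlux.integrableOn_exp_mul_source (hψ : IsDiffuseFlux ω θ₀ ψ) (hθ₀ : 0 < cos θ₀)
    (hs : 0 < s) : IntegrableOn (fun τ => exp (-s * τ) * source ω θ₀ ψ τ) (Ioi 0) := by
  have hjoint := hψ.laplace_joint s hs
  rw [IntegrableOn, volume_restrict_prod] at hjoint
  have hbeam : IntegrableOn (fun τ => exp (-s * τ) * exp (-τ / cos θ₀)) (Ioi 0) :=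
    integrableOn_mul_exp_neg_div hθ₀ fun r hr => by
      simp only [← exp_add, ← add_mul]
      exact integrableOn_exp_mul_Ioi (by linarith) 0
  refine ((hjoint.integral_prod_right.const_mul (ω / (2 * π))).add
    (hbeam.const_mul (ω / (2 * π)))).congr (ae_of_all _ fun τ => ?_)
  simp only [Pi.add_apply, source, integral_const_mul,
    intervalIntegral.integral_of_le (neg_le_self pi_pos.le)]
  ring

lemma IsDiffuseFlux.solvesTransport (hψ : IsDiffuseFlux ω θ₀ ψ) (hθ : θ ∈ Ioc (-π) π)
    (hcos : cos θ ≠ 0) : SolvesTransport (cos θ) (source ω θ₀ ψ) (ψ θ) where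
  continuous_zero := hψ.continuous_zero θ hθ hcos
  differentiable := hψ.differentiable θ hθ hcos
  transport := hψ.transport θ hθ

lemma IsDiffuseFlux.apply_zero_eq_sourceLaplace (hψ : IsDiffuseFlux ω θ₀ ψ) (hθ₀ : 0 < cos θ₀)
    (hθ : θ ∈ Ioc (-π) π) (hcos : cos θ < 0) :
    ψ θ 0 = -(cos θ)⁻¹ * sourceLaplace ω θ₀ ψ (-cos θ) := by
  have hm : 0 < -cos θ := neg_pos.2 hcos
  have hgreen := (hψ.solvesTransport hθ hcos.ne).integral_mul_sub_integral_mul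
    (solvesTransport_exp hm.ne') (integrableOn_mul_exp_neg_div hm (hψ.laplace θ hθ))
    (integrableOn_mul_exp_neg_div hm fun s hs => hψ.integrableOn_exp_mul_source hθ₀ hs)
    (by simp only [Pi.zero_apply, mul_zero]; exact integrableOn_zero)
  simp only [Pi.zero_apply, mul_zero, integral_zero, sub_zero, neg_zero, zero_div, exp_zero,
    mul_one] at hgreen
  rw [sourceLaplace, hgreen, neg_mul_neg, inv_mul_cancel_left₀ hcos.ne]

end Source

section Reciprocity

variable {ω θ₀ θ₁ θ : ℝ} {ψ Φ : ℝ → ℝ → ℝ} {g : ℝ → ℝ}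

lemma abs_le_pi (hθ : θ ∈ Ioc (-π) π) : |θ| ≤ π := abs_le.2 ⟨hθ.1.le, hθ.2⟩

lemma abs_pi_sub_abs (hθ : θ ∈ Ioc (-π) π) : |(π - |θ|)| = π - |θ| :=
  abs_of_nonneg (sub_nonneg.2 (abs_le_pi hθ))

lemma pi_sub_abs_mem_Ioc (hθ : θ ∈ Ioc (-π) π) : π - |θ| ∈ Ioc (-π) π :=
  ⟨by linarith [abs_le_pi hθ, pi_pos], sub_le_self _ (abs_nonneg θ)⟩

lemma cos_pi_sub_abs (θ : ℝ) : cos (π - |θ|) = -cos θ := by rw [cos_pi_sub, cos_abs]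

lemma integral_comp_neg_cos (F : ℝ → ℝ) :
    ∫ θ in (-π)..π, F (-cos θ) = ∫ θ in (-π)..π, F (cos θ) := by
  have hperiodic : Function.Periodic (fun θ => F (cos θ)) (2 * π) := fun θ => by
    simp only [cos_add_two_pi]
  have hshift := hperiodic.intervalIntegral_add_eq (-π) 0
  simp only [← cos_add_pi]
  rw [intervalIntegral.integral_comp_add_right fun θ => F (cos θ)]
  convert hshift.symm using 2 <;> ring

lemma ae_restrict_prod_of_forall_snd {A B : Set ℝ} (hA : MeasurableSet A) (hB : MeasurableSet B)
    {P : ℝ × ℝ → Prop} (hP : ∀ x, ∀ y ∈ B, P (x, y)) : ∀ᵐ p ∂volume.restrict (A ×ˢ B), P p := by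
  filter_upwards [ae_restrict_mem (hA.prod hB)] with p hp using hP p.1 p.2 hp.2

namespace IsDecayingFlux

lemma exists_abs_source_le (hΦ : IsDecayingFlux ω θ₁ Φ) (hθ₁ : 0 < cos θ₁) :
    ∃ ε > 0, ∃ M, ∀ τ, 0 < τ → |source ω θ₁ (fun θ => Φ (cos θ)) τ| ≤ M * exp (-ε * τ) := by
  obtain ⟨ε, ⟨hε0, hε1⟩, M, hM⟩ := hΦ.decay
  refine ⟨ε, hε0, |ω / (2 * π)| * (M * (2 * π) + 1), fun τ hτ => ?_⟩
  have hdensity : |∫ θ in (-π)..π, Φ (cos θ) τ| ≤ M * exp (-ε * τ) * (2 * π) := by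
    have hle := intervalIntegral.norm_integral_le_of_norm_le_const (a := -π) (b := π)
      (f := fun θ => Φ (cos θ) τ) fun θ _ => hM θ τ hτ
    rwa [sub_neg_eq_add, ← two_mul, abs_of_pos two_pi_pos] at hle
  have hbeam : exp (-τ / cos θ₁) ≤ exp (-ε * τ) := by
    rw [exp_le_exp, neg_div, neg_mul, neg_le_neg_iff]
    exact (mul_le_of_le_one_left hτ.le hε1.le).trans (le_div_self hτ.le hθ₁ (cos_le_one θ₁))
  calc |source ω θ₁ (fun θ => Φ (cos θ)) τ|
      ≤ |ω / (2 * π)| * (|∫ θ in (-π)..π, Φ (cos θ) τ| + exp (-τ / cos θ₁)) := by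
        rw [source, ← mul_add, abs_mul]
        gcongr
        exact (abs_add_le _ _).trans_eq (by rw [abs_exp])
    _ ≤ |ω / (2 * π)| * (M * exp (-ε * τ) * (2 * π) + exp (-ε * τ)) := by gcongr
    _ = |ω / (2 * π)| * (M * (2 * π) + 1) * exp (-ε * τ) := by ring

lemma integrableOn_mul_apply (hΦ : IsDecayingFlux ω θ₁ Φ) (hθ : θ ∈ Ioc (-π) π)
    (hg : ∀ s, 0 < s → IntegrableOn (fun τ => exp (-s * τ) * g τ) (Ioi 0)) :
    IntegrableOn (fun τ => g τ * Φ (cos θ) τ) (Ioi 0) := by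
  obtain ⟨ε, ⟨hε0, -⟩, M, hM⟩ := hΦ.decay
  have hmeas := aestronglyMeasurable_of_mul_left (by fun_prop) (fun τ => (exp_pos (-1 * τ)).ne')
    (hΦ.isDiffuseFlux.laplace θ hθ 1 one_pos).aestronglyMeasurable
  exact integrableOn_mul_of_abs_le_exp (hg ε hε0) hmeas (hM θ)

lemma aestronglyMeasurable_source (hΦ : IsDecayingFlux ω θ₁ Φ) (hθ₁ : 0 < cos θ₁) :
    AEStronglyMeasurable (source ω θ₁ fun θ => Φ (cos θ)) (volume.restrict (Ioi 0)) :=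
  aestronglyMeasurable_of_mul_left (by fun_prop) (fun τ => (exp_pos (-1 * τ)).ne')
    (hΦ.isDiffuseFlux.integrableOn_exp_mul_source hθ₁ one_pos).aestronglyMeasurable

lemma integrableOn_mul_source (hΦ : IsDecayingFlux ω θ₁ Φ) (hθ₁ : 0 < cos θ₁)
    (hg : ∀ s, 0 < s → IntegrableOn (fun τ => exp (-s * τ) * g τ) (Ioi 0)) :
    IntegrableOn (fun τ => g τ * source ω θ₁ (fun θ => Φ (cos θ)) τ) (Ioi 0) := by
  obtain ⟨ε, hε, M, hM⟩ := hΦ.exists_abs_source_le hθ₁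
  exact integrableOn_mul_of_abs_le_exp (hg ε hε) (hΦ.aestronglyMeasurable_source hθ₁) hM

lemma integrableOn_snd_mul_apply (hΦ : IsDecayingFlux ω θ₁ Φ)
    (hg : ∀ s, 0 < s → IntegrableOn (fun τ => exp (-s * τ) * g τ) (Ioi 0)) :
    IntegrableOn (fun p : ℝ × ℝ => g p.2 * Φ (cos p.1) p.2) (Ioc (-π) π ×ˢ Ioi 0) := by
  obtain ⟨ε, ⟨hε, -⟩, M, hM⟩ := hΦ.decay
  have hmeas := aestronglyMeasurable_of_mul_left (by fun_prop)
    (fun p : ℝ × ℝ => (exp_pos (-1 * p.2)).ne')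
    (hΦ.isDiffuseFlux.laplace_joint 1 one_pos).aestronglyMeasurable
  exact integrable_mul_of_abs_le_mul (by fun_prop) (fun p : ℝ × ℝ => exp_pos (-ε * p.2))
    (integrableOn_comp_snd (hg ε hε)) hmeas
    (ae_restrict_prod_of_forall_snd measurableSet_Ioc measurableSet_Ioi hM)

lemma integrableOn_prod_mul_source (hΦ : IsDecayingFlux ω θ₁ Φ) (hθ₁ : 0 < cos θ₁)
    (hψ : ∀ s, 0 < s →
      IntegrableOn (fun p : ℝ × ℝ => exp (-s * p.2) * ψ p.1 p.2) (Ioc (-π) π ×ˢ Ioi 0)) :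
    IntegrableOn (fun p : ℝ × ℝ => ψ p.1 p.2 * source ω θ₁ (fun θ => Φ (cos θ)) p.2)
      (Ioc (-π) π ×ˢ Ioi 0) := by
  obtain ⟨ε, hε, M, hM⟩ := hΦ.exists_abs_source_le hθ₁
  have hmeas : AEStronglyMeasurable
      (fun p : ℝ × ℝ => source ω θ₁ (fun θ => Φ (cos θ)) p.2)
      (volume.restrict (Ioc (-π) π ×ˢ Ioi 0)) := by
    rw [volume_restrict_prod]
    exact (hΦ.aestronglyMeasurable_source hθ₁).comp_snd
  exact integrable_mul_of_abs_le_mul (by fun_prop) (fun p : ℝ × ℝ => exp_pos (-ε * p.2))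
    (hψ ε hε) hmeas
    (ae_restrict_prod_of_forall_snd measurableSet_Ioc measurableSet_Ioi fun _ => hM)

lemma integral_source_mul_apply_neg_cos (hΦ : IsDecayingFlux ω θ₁ Φ) (hθ₁ : 0 < cos θ₁)
    (hψ : IsDiffuseFlux ω θ₀ ψ) (hθ₀ : 0 < cos θ₀) (hθ : θ ∈ Ioc (-π) π) (hcos : cos θ ≠ 0) :
    ∫ τ in Ioi 0, source ω θ₀ ψ τ * Φ (-cos θ) τ =
      ∫ τ in Ioi 0, ψ θ τ * source ω θ₁ (fun θ => Φ (cos θ)) τ := by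
  have hopp := pi_sub_abs_mem_Ioc hθ
  have hsolves := hΦ.isDiffuseFlux.solvesTransport hopp
    (by rw [cos_pi_sub_abs]; exact neg_ne_zero.2 hcos)
  have hψΦ := hΦ.integrableOn_mul_apply hopp (hψ.laplace θ hθ)
  have hSΦ := hΦ.integrableOn_mul_apply hopp fun s => hψ.integrableOn_exp_mul_source hθ₀
  have hentry : ψ θ 0 * Φ (cos (π - |θ|)) 0 = 0 := by
    obtain hin | hout := le_total |θ| (π / 2)
    · rw [hψ.no_reentrant θ hin, zero_mul]
    · have hback : |(π - |θ|)| ≤ π / 2 := by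
        rw [abs_pi_sub_abs hθ]
        linarith
      rw [hΦ.isDiffuseFlux.no_reentrant _ hback, mul_zero]
  rw [cos_pi_sub_abs] at hsolves hψΦ hSΦ hentry
  have hgreen := (hψ.solvesTransport hθ hcos).integral_mul_sub_integral_mul hsolves hψΦ hSΦ
    (hΦ.integrableOn_mul_source hθ₁ (hψ.laplace θ hθ))
  rwa [hentry, mul_zero, neg_zero, sub_eq_zero] at hgreen

lemma integral_source_mul_density (hΦ : IsDecayingFlux ω θ₁ Φ) (hθ₁ : 0 < cos θ₁)
    (hψ : IsDiffuseFlux ω θ₀ ψ) (hθ₀ : 0 < cos θ₀) :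
    ∫ τ in Ioi 0, source ω θ₀ ψ τ * ∫ θ in (-π)..π, Φ (cos θ) τ =
      ∫ τ in Ioi 0, (∫ θ in (-π)..π, ψ θ τ) * source ω θ₁ (fun θ => Φ (cos θ)) τ := by
  have hπ : -π ≤ π := neg_le_self pi_pos.le
  calc ∫ τ in Ioi 0, source ω θ₀ ψ τ * ∫ θ in (-π)..π, Φ (cos θ) τ
      = ∫ θ in (-π)..π, ∫ τ in Ioi 0, source ω θ₀ ψ τ * Φ (cos θ) τ := by
        rw [intervalIntegral_setIntegral_swap hπ <| hΦ.integrableOn_snd_mul_apply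
          fun s => hψ.integrableOn_exp_mul_source hθ₀]
        simp only [intervalIntegral.integral_const_mul]
    _ = ∫ θ in (-π)..π, ∫ τ in Ioi 0, source ω θ₀ ψ τ * Φ (-cos θ) τ :=
        (integral_comp_neg_cos fun μ => ∫ τ in Ioi 0, source ω θ₀ ψ τ * Φ μ τ).symm
    _ = ∫ θ in (-π)..π, ∫ τ in Ioi 0, ψ θ τ * source ω θ₁ (fun θ => Φ (cos θ)) τ := by
        refine intervalIntegral.integral_congr_ae ?_
        filter_upwards [ae_cos_ne_zero] with θ hcos hθ
        rw [uIoc_of_le hπ] at hθ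
        exact hΦ.integral_source_mul_apply_neg_cos hθ₁ hψ hθ₀ hθ hcos
    _ = ∫ τ in Ioi 0, (∫ θ in (-π)..π, ψ θ τ) * source ω θ₁ (fun θ => Φ (cos θ)) τ := by
        rw [intervalIntegral_setIntegral_swap hπ <|
          hΦ.integrableOn_prod_mul_source hθ₁ hψ.laplace_joint]
        simp only [intervalIntegral.integral_mul_const]

theorem sourceLaplace_reciprocity (hΦ : IsDecayingFlux ω θ₁ Φ) (hθ₁ : 0 < cos θ₁)
    (hψ : IsDiffuseFlux ω θ₀ ψ) (hθ₀ : 0 < cos θ₀) :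
    sourceLaplace ω θ₀ ψ (cos θ₁) = sourceLaplace ω θ₁ (fun θ => Φ (cos θ)) (cos θ₀) := by
  rcases eq_or_ne ω 0 with rfl | hω
  · simp [sourceLaplace, source]
  set a := ω / (2 * π)
  have ha0 : a ≠ 0 := div_ne_zero hω two_pi_pos.ne'
  set S := source ω θ₀ ψ with hS
  set R := source ω θ₁ fun θ => Φ (cos θ) with hR
  have hSlap : ∀ s, 0 < s → IntegrableOn (fun τ => exp (-s * τ) * S τ) (Ioi 0) :=
    fun s => hψ.integrableOn_exp_mul_source hθ₀
  have hSR : IntegrableOn (fun τ => S τ * R τ) (Ioi 0) := hΦ.integrableOn_mul_source hθ₁ hSlap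
  have hSbeam := (integrableOn_mul_exp_neg_div hθ₁ hSlap).const_mul a
  have hRbeam := (integrableOn_mul_exp_neg_div hθ₀
    fun s => hΦ.isDiffuseFlux.integrableOn_exp_mul_source hθ₁).const_mul a
  have hdensity := congrArg (a * ·) (hΦ.integral_source_mul_density hθ₁ hψ hθ₀)
  have hleft : ∀ τ, a * (S τ * ∫ θ in (-π)..π, Φ (cos θ) τ) =
      S τ * R τ - a * (S τ * exp (-τ / cos θ₁)) := fun τ => by
    rw [hR, source]
    ring
  have hright : ∀ τ, a * ((∫ θ in (-π)..π, ψ θ τ) * R τ) =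
      S τ * R τ - a * (R τ * exp (-τ / cos θ₀)) := fun τ => by
    rw [hS, source]
    ring
  simp only [← integral_const_mul, ← hS, ← hR, hleft, hright] at hdensity
  rw [integral_sub hSR hSbeam, integral_sub hSR hRbeam, sub_right_inj, integral_const_mul,
    integral_const_mul] at hdensity
  exact mul_left_cancel₀ ha0 hdensity

end IsDecayingFlux

end Reciprocity

section DiffuseReflection

variable {ω θ₀ θ : ℝ} {D : ℝ → ℝ → ℝ}

lemma cos_neg_of_pi_div_two_lt_abs (hθ : θ ∈ Ioc (-π) π) (hout : π / 2 < |θ|) : cos θ < 0 := by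
  rw [← cos_abs]
  refine cos_neg_of_pi_div_two_lt_of_lt hout ?_
  linarith [abs_le_pi hθ, pi_pos]

lemma isDiffuseReflection_iff : IsDiffuseReflection ω D ↔
    ∀ θ₀ ∈ Ioo (-(π / 2)) (π / 2), ∀ ψ, IsDiffuseFlux ω θ₀ ψ → ∀ θ ∈ Ioc (-π) π, π / 2 < |θ| →
      D (-cos θ) (cos θ₀) = sourceLaplace ω θ₀ ψ (-cos θ) := by
  refine forall₄_congr fun θ₀ hθ₀ ψ hψ => forall₃_congr fun θ hθ hout => ?_
  have hcos := cos_neg_of_pi_div_two_lt_abs hθ hout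
  rw [hψ.apply_zero_eq_sourceLaplace (cos_pos_of_mem_Ioo hθ₀) hθ hcos,
    mul_right_inj' (neg_ne_zero.2 (inv_ne_zero hcos.ne)), eq_comm]

lemma exists_isDiffuseReflection (hω : |ω| < 1) : ∃ D, IsDiffuseReflection ω D := by
  choose! Φ hΦ using fun θ₁ (hθ₁ : 0 < cos θ₁) => exists_isDecayingFlux hω hθ₁
  refine ⟨fun m m₀ => sourceLaplace ω (arccos m) (fun θ => Φ (arccos m) (cos θ)) m₀,
    isDiffuseReflection_iff.2 fun θ₀ hθ₀ ψ hψ θ hθ hout => ?_⟩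
  have harccos : cos (arccos (-cos θ)) = -cos θ :=
    cos_arccos (neg_le_neg (cos_le_one θ)) (neg_le.1 (neg_one_le_cos θ))
  have hpos : 0 < cos (arccos (-cos θ)) := by
    rw [harccos]
    exact neg_pos.2 (cos_neg_of_pi_div_two_lt_abs hθ hout)
  rw [← (hΦ _ hpos).sourceLaplace_reciprocity hpos hψ (cos_pos_of_mem_Ioo hθ₀), harccos]

lemma IsDiffuseReflection.symm (hω : |ω| < 1) (hD : IsDiffuseReflection ω D)
    (hθ₀ : θ₀ ∈ Ioo (-(π / 2)) (π / 2)) (hθ : θ ∈ Ioc (-π) π) (hout : π / 2 < |θ|) :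
    D (cos θ₀) (-cos θ) = D (-cos θ) (cos θ₀) := by
  have hreflect := isDiffuseReflection_iff.1 hD
  have hin₀ : |θ₀| < π / 2 := abs_lt.2 hθ₀
  have hin₁ : π - |θ| ∈ Ioo (-(π / 2)) (π / 2) :=
    ⟨by linarith [abs_le_pi hθ, pi_pos], by linarith⟩
  have hθ₀Ioc : θ₀ ∈ Ioc (-π) π := ⟨by linarith [hθ₀.1, pi_pos], by linarith [hθ₀.2, pi_pos]⟩
  have hout₀ : π / 2 < |(π - |θ₀|)| := by
    rw [abs_pi_sub_abs hθ₀Ioc]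
    linarith
  have hpos₀ := cos_pos_of_mem_Ioo hθ₀
  have hpos₁ := cos_pos_of_mem_Ioo hin₁
  obtain ⟨Φ₀, hΦ₀⟩ := exists_isDecayingFlux hω hpos₀
  obtain ⟨Φ₁, hΦ₁⟩ := exists_isDecayingFlux hω hpos₁
  have hforward := hreflect θ₀ hθ₀ _ hΦ₀.isDiffuseFlux θ hθ hout
  have hbackward := hreflect _ hin₁ _ hΦ₁.isDiffuseFlux _ (pi_sub_abs_mem_Ioc hθ₀Ioc) hout₀
  have hreciprocity := hΦ₁.sourceLaplace_reciprocity hpos₁ hΦ₀.isDiffuseFlux hpos₀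
  rw [cos_pi_sub_abs] at hreciprocity
  rw [cos_pi_sub_abs, cos_pi_sub_abs, neg_neg] at hbackward
  rw [hbackward, hforward, hreciprocity]

end DiffuseReflection

theorem mainTheorem2_general (ω : ℝ) (hω : |ω| < 1) :
    (∀ θ₀ ∈ Ioo (-(π / 2)) (π / 2), ∃ ψ : ℝ → ℝ → ℝ, IsDiffuseFlux ω θ₀ ψ) ∧
    (∃ D : ℝ → ℝ → ℝ, IsDiffuseReflection ω D) ∧
    (∀ D : ℝ → ℝ → ℝ, IsDiffuseReflection ω D →
      ∀ θ₀ ∈ Ioo (-(π / 2)) (π / 2), ∀ θ ∈ Ioc (-π) π, π / 2 < |θ| →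
        D (cos θ₀) (-cos θ) = D (-cos θ) (cos θ₀)) := by
  refine ⟨fun θ₀ hθ₀ => ?_, exists_isDiffuseReflection hω,
    fun D hD θ₀ hθ₀ θ hθ hout => hD.symm hω hθ₀ hθ hout⟩
  obtain ⟨Φ, hΦ⟩ := exists_isDecayingFlux hω (cos_pos_of_mem_Ioo hθ₀)
  exact ⟨fun θ => Φ (cos θ), hΦ.isDiffuseFlux⟩

theorem mainTheorem2 (ω : ℝ) (hω₀ : 0 ≤ ω) (hω₁ : ω < 1) :
    (∀ θ₀ ∈ Ioo (-(Real.pi / 2)) (Real.pi / 2), ∃ ψ : ℝ → ℝ → ℝ, IsDiffuseFlux ω θ₀ ψ) ∧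
    (∃ D : ℝ → ℝ → ℝ, IsDiffuseReflection ω D) ∧
    (∀ D : ℝ → ℝ → ℝ, IsDiffuseReflection ω D →
      ∀ θ₀ ∈ Ioo (-(Real.pi / 2)) (Real.pi / 2),
        ∀ θ ∈ Ioc (-Real.pi) Real.pi, Real.pi / 2 < |θ| →
          D (Real.cos θ₀) (-Real.cos θ) = D (-Real.cos θ) (Real.cos θ₀)) :=
  mainTheorem2_general ω (by rwa [abs_of_nonneg hω₀])
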